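/- Let $S$ be an inverse semigroup: a semigroup in which every $s$ has a unique $s^*$ with $ss^*s=s$ and $s^*ss^*=s^*$. Let $E$ be its set of idempotents, and write $s\mathrel{\mathcal L}t$ if $us=t$ and $vt=s$ for some $u,v\in S$. Suppose that $S$ is quasi-countable, i.e. generated as an inverse semigroup by $X\cup E$ for some countable $X\subseteq S$. Let $d\colon S\times S\to[0,\infty]$ be an extended metric that - is uniformly discrete (there is $c>0$ with $d(x,y)>c$ whenever $x\ne y$) and has the $\mathcal L$-classes as its components (i.e. $d(x,y)<\infty$ if and only if $x\mathrel{\mathcal L}y$); - is right subinvariant: $d(sx,tx)\le d(s,t)$ for all $s,t,x\in S$; - is proper: for every $r\ge 0$ there is a finite $F\subseteq S$ such that $y\in Fx$ whenever $x\neq y$ and $d(x,y)\le r$. Let $C_u^*(S,d)\subseteq\mathcal B(\ell^2(S))$ be the uniform Roe algebra, i.e. the C*-algebra generated by the operators $t$ of finite propagation (for some $r<\infty$, $\langle t\delta_x,\delta_y\rangle=0$ whenever $d(x,y)>r$). Then the following are equivalent: 1. $S$ is locally $\mathcal L$-finite: in each finitely generated inverse subsemigroup $T$ of $S$, all the $\mathcal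 L$-classes of $T$ are finite. 2. $(S,d)$ is sparse: every component of $(S,d)$ is the disjoint union of a finite or infinite sequence of nonempty finite sets $X_0,X_1,\dots$ such that $d(X_n,X_m)\to\infty$ as $n+m\to\infty$ with $n\ne m$. 3. $C_u^*(S,d)$ is quasi-diagonal: it has a faithful representation on a Hilbert space $H$ with image $B$ such that, for all finite $K\subseteq B$, finite $V\subseteq H$ and $\varepsilon>0$, there is a finite rank orthogonal projection $p$ on $H$ with $\|pa-ap\|\le\varepsilon$ for all $a\in K$ and $\|pv-v\|\le\varepsilon$ for all $v\in V$. 4. $C_u^*(S,d)$ is stably finite: $M_n(C_u^*(S,d))$ is finite for every $n$. 5. $C_u^*(S,d)$ is finite: it contains no $v$ with $v^*v=1$ and $vv^*\neq1$. Say that $(S,d)$ has asymptotic dimension $0$ if for every $r>0$ there is a cover of $S$ by sets of uniformly bounded (finite) diameter, any two distinct members of which are at distance greater than $r$. If $(S,d)$ has asymptotic dimension $0$, then the conditions 1–5 hold. The converse holds if $S$ is a group, but not in general: there are a quasi-countable inverse semigroup and a metric $d$ on it with the properties above for which $(S,d)$ is sparse but not of asymptotic dimension $0$. -/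

import Mathlib

open scoped ENNReal NNReal

universe u

namespace InvSemigroupRoe

/-! ### Inverse semigroups -/

/-- An inverse semigroup: every `s` has exactly one inverse `s⁻¹`, in the sense that
`s * s⁻¹ * s = s` and `s⁻¹ * s * s⁻¹ = s⁻¹`. -/
class InverseSemigroup (S : Type u) extends Semigroup S, Inv S where
  mul_inv_mul_self : ∀ s : S, s * s⁻¹ * s = s
  inv_mul_self_mul_inv : ∀ s : S, s⁻¹ * s * s⁻¹ = s⁻¹
  eq_inv_of_inverse : ∀ s t : S, s * t * s = s → t * s * t = t → t = s⁻¹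

/-- Every group is an inverse semigroup, with the same product and inverse. -/
instance groupInverseSemigroup (G : Type u) [Group G] : InverseSemigroup G where
  mul_inv_mul_self s := by group
  inv_mul_self_mul_inv s := by group
  eq_inv_of_inverse s t h _ := by
    have h' : s * t = 1 := by simpa using congrArg (· * s⁻¹) h
    exact (inv_eq_of_mul_eq_one_right h').symm

/-- Green's relation `𝓛`: `s` and `t` are left multiples of each other. -/
def LRel {S : Type u} [InverseSemigroup S] (s t : S) : Prop :=
  (∃ a : S, a * s = t) ∧ (∃ b : S, b * t = s)

/-- A subset closed under products and inverses. -/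
structure InverseSubsemigroup (S : Type u) [InverseSemigroup S] where
  carrier : Set S
  mul_mem' : ∀ {a b : S}, a ∈ carrier → b ∈ carrier → a * b ∈ carrier
  inv_mem' : ∀ {a : S}, a ∈ carrier → a⁻¹ ∈ carrier

namespace InverseSubsemigroup

variable {S : Type u} [InverseSemigroup S]

instance : SetLike (InverseSubsemigroup S) S where
  coe T := T.carrier
  coe_injective T T' h := by
    cases T; cases T'; congr

instance (T : InverseSubsemigroup S) : InverseSemigroup T where
  mul a b := ⟨(a : S) * (b : S), T.mul_mem' a.2 b.2⟩
  inv a := ⟨(a : S)⁻¹, T.inv_mem' a.2⟩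
  mul_assoc a b c := Subtype.ext (mul_assoc (a : S) b c)
  mul_inv_mul_self s := Subtype.ext (InverseSemigroup.mul_inv_mul_self (s : S))
  inv_mul_self_mul_inv s := Subtype.ext (InverseSemigroup.inv_mul_self_mul_inv (s : S))
  eq_inv_of_inverse s t h h' := Subtype.ext
    (InverseSemigroup.eq_inv_of_inverse (s : S) t
      (congrArg Subtype.val h) (congrArg Subtype.val h'))

/-- The inverse subsemigroup `⟨X⟩` generated by `X`: the intersection of all inverse
subsemigroups that contain `X`. -/
def closure (X : Set S) : InverseSubsemigroup S where
  carrier := {s | ∀ T : InverseSubsemigroup S, X ⊆ (T : Set S) → s ∈ T}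
  mul_mem' ha hb T hT := T.mul_mem' (ha T hT) (hb T hT)
  inv_mem' ha T hT := T.inv_mem' (ha T hT)

/-- `T` is finitely generated as an inverse semigroup. -/
def FG (T : InverseSubsemigroup S) : Prop :=
  ∃ F : Set S, F.Finite ∧ T = closure F

end InverseSubsemigroup

/-- `S = ⟨X ∪ E⟩` for some countable set `X`, where `E` is the set of idempotents. -/
def IsQuasiCountable (S : Type u) [InverseSemigroup S] : Prop :=
  ∃ X : Set S, X.Countable ∧
    ∀ s : S, s ∈ InverseSubsemigroup.closure (X ∪ {e : S | IsIdempotentElem e})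

/-- All `𝓛`-classes are finite. -/
def IsLFinite (S : Type u) [InverseSemigroup S] : Prop :=
  ∀ s : S, {t : S | LRel s t}.Finite

/-- Every finitely generated inverse subsemigroup is `𝓛`-finite (with respect to its own
relation `𝓛`). -/
def IsLocallyLFinite (S : Type u) [InverseSemigroup S] : Prop :=
  ∀ T : InverseSubsemigroup S, T.FG → IsLFinite T

/-! ### Extended metrics -/

/-- The distance between two sets; it is `∞` if one of them is empty. -/
noncomputable def setEDist {X : Type u} [EMetricSpace X] (A B : Set X) : ℝ≥0∞ :=
  ⨅ x ∈ A, ⨅ y ∈ B, edist x y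

/-- The component of `p`: all points at finite distance from `p`. -/
def component {X : Type u} [EMetricSpace X] (p : X) : Set X :=
  {x | edist p x < ∞}

/-- Sparseness: every component `C` is the disjoint union of finite sets `A 0, A 1, …` such that
the distance of `A n` and `A m`, for `n ≠ m`, tends to infinity as `n + m → ∞`. Some of the `A n`
may be empty, so that finite unions are covered; in particular finite components are allowed. -/
def IsSparse (X : Type u) [EMetricSpace X] : Prop :=
  ∀ p : X, ∃ A : ℕ → Set X,
    (∀ n, (A n).Finite) ∧
    (∀ n m, n ≠ m → Disjoint (A n) (A m)) ∧
    (⋃ n, A n) = component p ∧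
    ∀ R : ℝ≥0, ∃ N : ℕ, ∀ n m, n ≠ m → N ≤ n + m → (R : ℝ≥0∞) < setEDist (A n) (A m)

/-- Asymptotic dimension `0`: for every `r > 0` there is a cover by sets of uniformly bounded
diameter that are pairwise more than `r` apart. -/
def HasAsdimZero (X : Type u) [EMetricSpace X] : Prop :=
  ∀ r : ℝ≥0, 0 < r → ∃ U : Set (Set X),
    ⋃₀ U = Set.univ ∧
    (∃ D : ℝ≥0, ∀ A ∈ U, ∀ x ∈ A, ∀ y ∈ A, edist x y ≤ D) ∧
    ∀ A ∈ U, ∀ B ∈ U, A ≠ B → (r : ℝ≥0∞) < setEDist A B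

/-- The given extended metric on the inverse semigroup `S` is uniformly discrete, its components
are exactly the `𝓛`-classes, and it is right subinvariant and proper. -/
structure IsProperRightSubinvariant (S : Type u) [InverseSemigroup S] [EMetricSpace S] :
    Prop where
  uniformlyDiscrete : ∃ c : ℝ≥0, 0 < c ∧ ∀ x y : S, x ≠ y → (c : ℝ≥0∞) < edist x y
  component_eq : ∀ x y : S, edist x y < ∞ ↔ LRel x y
  rightSubinvariant : ∀ s t x : S, edist (s * x) (t * x) ≤ edist s t
  proper : ∀ r : ℝ≥0, ∃ F : Set S, F.Finite ∧
    ∀ x y : S, x ≠ y → edist x y ≤ r → ∃ f ∈ F, y = f * x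

/-! ### The uniform Roe algebra -/

/-- The Hilbert space `ℓ²(X)`. -/
abbrev EllTwo (X : Type u) : Type u := lp (fun _ : X => ℂ) 2

open Classical in
/-- The basis vector `δ_x` of `ℓ²(X)`. -/
noncomputable def delta {X : Type u} (x : X) : EllTwo X := lp.single 2 x (1 : ℂ)

/-- `t` has finite propagation: for some finite `r ≥ 0`, the matrix coefficient
`⟨t δ_x, δ_y⟩` vanishes whenever `d(x, y) > r`. -/
def HasFinitePropagation {X : Type u} [EMetricSpace X] (t : EllTwo X →L[ℂ] EllTwo X) : Prop :=
  ∃ r : ℝ≥0, ∀ x y : X, (r : ℝ≥0∞) < edist x y → inner ℂ (t (delta x)) (delta y) = 0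

/-- The uniform Roe algebra: the norm-closed `*`-subalgebra of `B(ℓ²(X))` generated by the
operators of finite propagation. -/
noncomputable def uniformRoeAlgebra (X : Type u) [EMetricSpace X] :
    StarSubalgebra ℂ (EllTwo X →L[ℂ] EllTwo X) :=
  (StarAlgebra.adjoin ℂ
    {t : EllTwo X →L[ℂ] EllTwo X | HasFinitePropagation t}).topologicalClosure

/-! ### Finiteness properties of (unital) C*-algebras -/

/-- There is no proper isometry. If `v* v = 1` then `v v*` is a projection, so that `v v* < 1`
means the same as `v v* ≠ 1`. -/
def IsFiniteAlg (A : Type u) [Ring A] [StarRing A] : Prop :=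
  ¬ ∃ v : A, star v * v = 1 ∧ v * star v ≠ 1

/-- All the matrix algebras `M_n(A)`, with the conjugate transpose as `*`, are finite. -/
def IsStablyFinite (A : Type u) [Ring A] [StarRing A] : Prop :=
  ∀ n : ℕ, IsFiniteAlg (Matrix (Fin n) (Fin n) A)

/-- A quasi-diagonal set of operators on a Hilbert space. -/
def IsQuasidiagonalSet {H : Type u} [NormedAddCommGroup H] [InnerProductSpace ℂ H]
    [CompleteSpace H] (Ω : Set (H →L[ℂ] H)) : Prop :=
  ∀ F : Set (H →L[ℂ] H), F ⊆ Ω → F.Finite → ∀ ε : ℝ, 0 < ε → ∀ V : Set H, V.Finite →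
    ∃ p : H →L[ℂ] H, IsStarProjection p ∧
      FiniteDimensional ℂ (LinearMap.range (p : H →ₗ[ℂ] H)) ∧
      (∀ ω ∈ F, ‖p * ω - ω * p‖ ≤ ε) ∧ ∀ v ∈ V, ‖p v - v‖ ≤ ε

/-- `A` has a faithful representation on a Hilbert space whose image is a quasi-diagonal set of
operators. -/
def IsQuasidiagonal (A : Type u) [Ring A] [StarRing A] [Algebra ℂ A] : Prop :=
  ∃ (H : Type u) (_ : NormedAddCommGroup H) (_ : InnerProductSpace ℂ H) (_ : CompleteSpace H)
    (π : A →⋆ₐ[ℂ] (H →L[ℂ] H)), Function.Injective π ∧ IsQuasidiagonalSet (Set.range π)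

end InvSemigroupRoe

open InvSemigroupRoe

/-! Everything passes through the finiteness of the connected components of the Rips graphs of
`S` at every scale. For a metric with finite balls this is sparseness. For a proper right
subinvariant metric it is also local `𝓛`-finiteness: a path in a Rips graph multiplies its starting
point on the left by a word in a fixed finite set, and conversely every letter of such a word moves
a point by a bounded distance.

If all Rips components are finite, the projections onto their finite unions commute with operators
of small propagation, so the uniform Roe algebra is quasi-diagonal. Compressing an isometry to an
almost commuting finite rank projection shows that quasi-diagonality implies stable finiteness. If
some Rips component is infinite, it contains an injective ray, whose shift is a proper isometry of
finite propagation.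

Asymptotic dimension `0` says that the Rips components are even uniformly bounded. In a group the
right translations make them so as soon as they are finite. For the counterexample, the prefix
expansion of `ℤ` has finite components containing arbitrarily long intervals. -/

namespace InvSemigroupRoe

/-! ### Components of Rips graphs -/

theorem exists_nnreal_forall_le_of_finite {ι : Type*} {s : Set ι} (hs : s.Finite)
    {f : ι → ℝ≥0∞} (hf : ∀ i ∈ s, f i < ∞) : ∃ D : ℝ≥0, ∀ i ∈ s, f i ≤ D := by
  obtain ⟨D, hD⟩ := (hs.image fun i => (f i).toNNReal).bddAbove
  refine ⟨D, fun i hi => ?_⟩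
  rw [← ENNReal.coe_toNNReal (hf i hi).ne]
  exact_mod_cast hD ⟨i, hi, rfl⟩

section Rips

variable {X : Type u} [EMetricSpace X]

/-- The Rips graph at scale `r`: two distinct points are adjacent if their distance is at
most `r`. -/
def ripsGraph (X : Type u) [EMetricSpace X] (r : ℝ≥0) : SimpleGraph X where
  Adj x y := x ≠ y ∧ edist x y ≤ r
  symm := ⟨fun x y ⟨hne, hle⟩ => ⟨hne.symm, edist_comm x y ▸ hle⟩⟩
  loopless := ⟨fun _ h => h.1 rfl⟩

/-- The Rips components at every scale are finite. This is the metric form of conditions 1–5. -/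
def HasFiniteRipsComponents (X : Type u) [EMetricSpace X] : Prop :=
  ∀ (r : ℝ≥0) (p : X), {y | (ripsGraph X r).Reachable p y}.Finite

/-- Local finiteness of the metric: balls of finite radius are finite. -/
def HasFiniteBalls (X : Type u) [EMetricSpace X] : Prop :=
  ∀ (r : ℝ≥0) (p : X), {y | edist p y ≤ r}.Finite

/-- `Y` is a union of Rips components at scale `r`, expressed through single steps. -/
def IsRipsClosed (r : ℝ≥0) (Y : Set X) : Prop :=
  ∀ ⦃x y⦄, edist x y ≤ r → x ∈ Y → y ∈ Y

/-- The union of the Rips components at scale `r` that meet `A`. -/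
def ripsHull (r : ℝ≥0) (A : Set X) : Set X :=
  {y | ∃ x ∈ A, (ripsGraph X r).Reachable x y}

theorem reachable_of_edist_le {r : ℝ≥0} {x y : X} (h : edist x y ≤ r) :
    (ripsGraph X r).Reachable x y := by
  by_cases hxy : x = y
  · exact hxy ▸ .rfl
  · exact SimpleGraph.Adj.reachable ⟨hxy, h⟩

theorem ripsGraph_mono {r r' : ℝ≥0} (hr : r ≤ r') : ripsGraph X r ≤ ripsGraph X r' :=
  fun _ _ ⟨hne, hle⟩ => ⟨hne, hle.trans (by exact_mod_cast hr)⟩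

theorem IsRipsClosed.mem_of_reachable {r : ℝ≥0} {Y : Set X} (hY : IsRipsClosed r Y) {x y : X}
    (hx : x ∈ Y) (h : (ripsGraph X r).Reachable x y) : y ∈ Y := by
  rw [SimpleGraph.reachable_iff_reflTransGen] at h
  induction h with
  | refl => exact hx
  | tail _ hadj ih => exact hY hadj.2 ih

theorem IsRipsClosed.anti {r r' : ℝ≥0} (hr : r ≤ r') {Y : Set X} (hY : IsRipsClosed r' Y) :
    IsRipsClosed r Y :=
  fun _ _ h hx => hY (h.trans (by exact_mod_cast hr)) hx

theorem isRipsClosed_component (r : ℝ≥0) (p : X) : IsRipsClosed r (component p) :=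
  fun x y hxy hx => (edist_triangle p x y).trans_lt
    (ENNReal.add_lt_top.2 ⟨hx, hxy.trans_lt ENNReal.coe_lt_top⟩)

theorem edist_lt_top_of_reachable {r : ℝ≥0} {x y : X} (h : (ripsGraph X r).Reachable x y) :
    edist x y < ∞ :=
  (isRipsClosed_component r x).mem_of_reachable (by simp [component]) h

theorem subset_ripsHull (r : ℝ≥0) (A : Set X) : A ⊆ ripsHull r A :=
  fun x hx => ⟨x, hx, .rfl⟩

theorem isRipsClosed_ripsHull (r : ℝ≥0) (A : Set X) : IsRipsClosed r (ripsHull r A) :=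
  fun _ _ hxy ⟨a, ha, hax⟩ => ⟨a, ha, hax.trans (reachable_of_edist_le hxy)⟩

theorem ripsHull_mono {r r' : ℝ≥0} (hr : r ≤ r') {A B : Set X} (hAB : A ⊆ B) :
    ripsHull r A ⊆ ripsHull r' B :=
  fun _ ⟨x, hx, hxy⟩ => ⟨x, hAB hx, hxy.mono (ripsGraph_mono hr)⟩

theorem HasFiniteRipsComponents.finite_ripsHull (h : HasFiniteRipsComponents X) (r : ℝ≥0)
    {A : Set X} (hA : A.Finite) : (ripsHull r A).Finite := by
  refine (hA.biUnion fun x _ => h r x).subset fun y ⟨x, hx, hxy⟩ => ?_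
  exact Set.mem_biUnion hx hxy

end Rips

section Sparse

variable {X : Type u} [EMetricSpace X]

theorem setEDist_le {A B : Set X} {x y : X} (hx : x ∈ A) (hy : y ∈ B) :
    setEDist A B ≤ edist x y :=
  (iInf₂_le x hx).trans (iInf₂_le y hy)

theorem le_setEDist {A B : Set X} {R : ℝ≥0∞} (h : ∀ x ∈ A, ∀ y ∈ B, R ≤ edist x y) :
    R ≤ setEDist A B :=
  le_iInf₂ fun x hx => le_iInf₂ fun y hy => h x hx y hy

theorem setEDist_comm (A B : Set X) : setEDist A B = setEDist B A :=
  le_antisymm (le_setEDist fun x hx y hy => edist_comm x y ▸ setEDist_le hy hx)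
    (le_setEDist fun x hx y hy => edist_comm x y ▸ setEDist_le hy hx)

theorem IsSparse.hasFiniteRipsComponents (h : IsSparse X) : HasFiniteRipsComponents X := by
  intro r p
  obtain ⟨A, hfin, -, hU, hA⟩ := h p
  obtain ⟨N, hN⟩ := hA r
  obtain ⟨n, hn⟩ := Set.mem_iUnion.1 (hU ▸ (by simp [component] : p ∈ component p))
  set M := max N (n + 1)
  have hclosed : IsRipsClosed r (⋃ m ∈ {m | m < M}, A m) := by
    intro x y hxy hx
    obtain ⟨m, hm, hxm⟩ := Set.mem_iUnion₂.1 hx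
    have hyU : y ∈ ⋃ k, A k :=
      hU ▸ isRipsClosed_component r p hxy (hU ▸ Set.mem_iUnion_of_mem m hxm)
    obtain ⟨k, hyk⟩ := Set.mem_iUnion.1 hyU
    by_contra hy
    have hk : M ≤ k := not_lt.1 fun hk => hy (Set.mem_biUnion hk hyk)
    have hmk : m ≠ k := (lt_of_lt_of_le hm hk).ne
    have hNk : N ≤ m + k := ((le_max_left _ _).trans hk).trans (Nat.le_add_left k m)
    exact ((hN m k hmk hNk).trans_le (setEDist_le hxm hyk)).not_ge hxy
  refine ((Set.finite_lt_nat M).biUnion fun m _ => hfin m).subset fun y hy => ?_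
  have hnM : n < M := le_max_right N (n + 1)
  exact hclosed.mem_of_reachable (Set.mem_biUnion hnM hn) hy

theorem le_setEDist_disjointed {Y : ℕ → Set X} (hmono : Monotone Y)
    (hclosed : ∀ k : ℕ, IsRipsClosed k (Y k)) {n m : ℕ} (hnm : n ≤ m) :
    ((m : ℝ≥0) : ℝ≥0∞) ≤ setEDist (disjointed Y n) (disjointed Y (m + 1)) := by
  refine le_setEDist fun x hx y hy => ?_
  rw [hmono.disjointed_add_one] at hy
  by_contra! hlt
  exact hy.2 (hclosed m hlt.le (hmono hnm (disjointed_subset Y n hx)))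

theorem HasFiniteRipsComponents.isSparse (hb : HasFiniteBalls X)
    (h : HasFiniteRipsComponents X) : IsSparse X := by
  intro p
  let Y : ℕ → Set X := fun k => ripsHull k {x | edist p x ≤ (k : ℝ≥0)}
  have hmono : Monotone Y := fun k l hkl => by
    have hkl' : (k : ℝ≥0) ≤ l := by exact_mod_cast hkl
    exact ripsHull_mono hkl' fun x (hx : edist p x ≤ _) => hx.trans (by exact_mod_cast hkl')
  have hU : ⋃ k, Y k = component p := by
    refine subset_antisymm (Set.iUnion_subset fun k y ⟨x, hx, hxy⟩ => ?_) fun y hy => ?_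
    · exact (isRipsClosed_component _ p).mem_of_reachable (hx.trans_lt ENNReal.coe_lt_top) hxy
    · obtain ⟨k, hk⟩ := ENNReal.exists_nat_gt (ne_of_lt hy)
      exact Set.mem_iUnion_of_mem k (subset_ripsHull _ _ (by simpa using hk.le))
  refine ⟨disjointed Y, fun n => (h.finite_ripsHull _ (hb _ p)).subset (disjointed_subset Y n),
    fun n m hnm => disjoint_disjointed Y hnm, iUnion_disjointed.trans hU, fun R => ?_⟩
  obtain ⟨k, hk⟩ := exists_nat_gt R
  have hfar : ∀ n m, n < m → k < m → (R : ℝ≥0∞) < setEDist (disjointed Y n) (disjointed Y m) := by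
    rintro n (_ | m) hnm hkm
    · simp at hnm
    · have hRm : R < (m : ℝ≥0) := hk.trans_le (by exact_mod_cast Nat.lt_succ_iff.1 hkm)
      exact (ENNReal.coe_lt_coe.2 hRm).trans_le (le_setEDist_disjointed hmono
        (fun _ => isRipsClosed_ripsHull _ _) (Nat.lt_succ_iff.1 hnm))
  refine ⟨2 * k + 1, fun n m hnm hN => ?_⟩
  rcases hnm.lt_or_gt with hlt | hlt
  · exact hfar n m hlt (by omega)
  · exact setEDist_comm (disjointed Y n) _ ▸ hfar m n hlt (by omega)

theorem hasAsdimZero_iff : HasAsdimZero X ↔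
    ∀ r : ℝ≥0, ∃ D : ℝ≥0, ∀ x y, (ripsGraph X r).Reachable x y → edist x y ≤ D := by
  refine ⟨fun h r => ?_, fun h r _ => ?_⟩
  · obtain ⟨U, hU, ⟨D, hD⟩, hsep⟩ := h (r + 1) (by positivity)
    have hclosed : ∀ A ∈ U, IsRipsClosed r A := fun A hA x y hxy hx => by
      obtain ⟨B, hB, hy⟩ := Set.mem_sUnion.1 (hU ▸ Set.mem_univ y)
      suffices A = B from this ▸ hy
      by_contra hAB
      refine ((hsep A hA B hB hAB).trans_le (setEDist_le hx hy)).not_ge (hxy.trans ?_)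
      exact_mod_cast le_self_add
    refine ⟨D, fun x y hxy => ?_⟩
    obtain ⟨A, hA, hx⟩ := Set.mem_sUnion.1 (hU ▸ Set.mem_univ x)
    exact hD A hA x hx y ((hclosed A hA).mem_of_reachable hx hxy)
  · obtain ⟨D, hD⟩ := h (r + 1)
    refine ⟨Set.range fun x => {y | (ripsGraph X (r + 1)).Reachable x y},
      Set.eq_univ_of_forall fun x => ⟨_, ⟨x, rfl⟩, .rfl⟩, ⟨D, ?_⟩, ?_⟩
    · rintro _ ⟨z, rfl⟩ x hx y hy
      exact hD x y (hx.symm.trans hy)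
    · rintro _ ⟨a, rfl⟩ _ ⟨b, rfl⟩ hab
      have hr : (r : ℝ≥0∞) < (r + 1 : ℝ≥0) := by exact_mod_cast lt_add_one r
      refine hr.trans_le (le_setEDist fun x hx y hy => ?_)
      by_contra! hlt
      have hconn : (ripsGraph X (r + 1)).Reachable a b :=
        (hx.trans (reachable_of_edist_le hlt.le)).trans hy.symm
      exact hab (Set.ext fun z => ⟨hconn.symm.trans, hconn.trans⟩)

theorem HasAsdimZero.hasFiniteRipsComponents (hb : HasFiniteBalls X) (h : HasAsdimZero X) :
    HasFiniteRipsComponents X := by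
  intro r p
  obtain ⟨D, hD⟩ := hasAsdimZero_iff.1 h r
  exact (hb D p).subset (hD p)

end Sparse

section Ray

variable {V : Type*} {G : SimpleGraph V}

/-- The points `y` for which some geodesic of `G` from `p` to `y` passes through `x`. -/
def geodesicCone (G : SimpleGraph V) (p x : V) : Set V :=
  {y | G.Reachable x y ∧ G.dist p y = G.dist p x + G.dist x y}

theorem geodesicCone_subset {p x : V} (hpx : G.Reachable p x) :
    geodesicCone G p x ⊆
      {x} ∪ ⋃ x' ∈ {x' ∈ G.neighborSet x | G.dist p x' = G.dist p x + 1}, geodesicCone G p x' := by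
  rintro y ⟨hxy, hy⟩
  obtain ⟨w, hw⟩ := hxy.exists_walk_length_eq_dist
  cases w with
  | nil => exact Or.inl rfl
  | @cons _ x' _ hadj w =>
    right
    have htail : G.dist x' y ≤ w.length := G.dist_le w
    have hpy : G.dist p y ≤ G.dist p x' + G.dist x' y :=
      (hpx.trans hadj.reachable).dist_triangle_left y
    have hpx' : G.dist p x' ≤ G.dist p x + G.dist x x' := hpx.dist_triangle_left x'
    have hxx' : G.dist x x' = 1 := SimpleGraph.dist_eq_one_iff_adj.2 hadj
    rw [SimpleGraph.Walk.length_cons] at hw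
    exact Set.mem_biUnion (x := x') ⟨hadj, by omega⟩ ⟨w.reachable, by omega⟩

theorem exists_adj_infinite_geodesicCone (hG : ∀ x, (G.neighborSet x).Finite) {p x : V}
    (hpx : G.Reachable p x) (hx : (geodesicCone G p x).Infinite) :
    ∃ x', G.Adj x x' ∧ G.dist p x' = G.dist p x + 1 ∧ (geodesicCone G p x').Infinite := by
  by_contra! hfin
  refine hx (((Set.finite_singleton x).union (((hG x).subset (Set.sep_subset _ _)).biUnion
    fun x' hx' => hfin x' hx'.1 hx'.2)).subset (geodesicCone_subset hpx))

theorem exists_ray (hG : ∀ x, (G.neighborSet x).Finite) {p : V}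
    (hp : {y | G.Reachable p y}.Infinite) :
    ∃ f : ℕ → V, Function.Injective f ∧ ∀ n, G.Adj (f n) (f (n + 1)) := by
  let W := {x // G.Reachable p x ∧ (geodesicCone G p x).Infinite}
  have step : ∀ x : W, ∃ x' : W, G.Adj x x' ∧ G.dist p x' = G.dist p x + 1 := by
    rintro ⟨x, hpx, hx⟩
    obtain ⟨x', hadj, hdist, hx'⟩ := exists_adj_infinite_geodesicCone hG hpx hx
    exact ⟨⟨x', hpx.trans hadj.reachable, hx'⟩, hadj, hdist⟩
  choose next hnext using step
  let f : ℕ → W := fun n => next^[n] ⟨p, .rfl, by simpa [geodesicCone] using hp⟩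
  have hf : ∀ n, f (n + 1) = next (f n) := fun n => Function.iterate_succ_apply' next n _
  have hdist : ∀ n, G.dist p (f n) = n := by
    intro n
    induction n with
    | zero => simp [f]
    | succ n ih => rw [hf, (hnext _).2, ih]
  refine ⟨fun n => f n, fun n m hnm => ?_, fun n => ?_⟩
  · rw [← hdist n, ← hdist m]
    exact congrArg _ hnm
  · simp only [hf]
    exact (hnext _).1

end Ray

/-! ### Local `𝓛`-finiteness -/

/-- Right multiplications do not increase distances. -/
def IsRightSubinvariant (S : Type u) [Mul S] [EDist S] : Prop :=
  ∀ s t x : S, edist (s * x) (t * x) ≤ edist s t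

/-- Properness of the metric: points at distance at most `r` differ by left multiplication with
an element of a finite set. -/
def IsProper (S : Type u) [Mul S] [EDist S] : Prop :=
  ∀ r : ℝ≥0, ∃ F : Set S, F.Finite ∧ ∀ x y : S, x ≠ y → edist x y ≤ r → ∃ f ∈ F, y = f * x

theorem IsRightSubinvariant.reachable_mul_right {S : Type u} [Mul S] [EMetricSpace S]
    (h : IsRightSubinvariant S) {r : ℝ≥0} {x y : S} (hxy : (ripsGraph S r).Reachable x y) (a : S) :
    (ripsGraph S r).Reachable (x * a) (y * a) := by
  have hclosed : IsRipsClosed r {y | (ripsGraph S r).Reachable (x * a) (y * a)} :=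
    fun y z hyz hy => hy.trans (reachable_of_edist_le ((h y z a).trans hyz))
  exact hclosed.mem_of_reachable (SimpleGraph.Reachable.refl _) hxy

theorem IsProper.hasFiniteBalls {S : Type u} [Mul S] [EMetricSpace S] (h : IsProper S) :
    HasFiniteBalls S := by
  intro r p
  obtain ⟨F, hF, hF'⟩ := h r
  refine ((hF.image (· * p)).insert p).subset fun y hy => ?_
  by_cases hpy : p = y
  · exact Or.inl hpy.symm
  · obtain ⟨f, hf, rfl⟩ := hF' p y hpy hy
    exact Or.inr ⟨f, hf, rfl⟩

theorem HasFiniteRipsComponents.hasAsdimZero {G : Type u} [Group G] [EMetricSpace G]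
    (h : IsRightSubinvariant G) (hC : HasFiniteRipsComponents G) : HasAsdimZero G := by
  refine hasAsdimZero_iff.2 fun r => ?_
  obtain ⟨D, hD⟩ := exists_nnreal_forall_le_of_finite (hC r 1) (f := edist 1)
    fun _ => edist_lt_top_of_reachable
  refine ⟨D, fun x y hxy => ?_⟩
  have hone : (ripsGraph G r).Reachable 1 (y * x⁻¹) := by
    simpa using h.reachable_mul_right hxy x⁻¹
  calc edist x y = edist (1 * x) (y * x⁻¹ * x) := by simp
    _ ≤ edist 1 (y * x⁻¹) := h _ _ _
    _ ≤ D := hD _ hone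

section InverseSemigroup

variable {S : Type u} [InverseSemigroup S]

open InverseSemigroup

instance : InvolutiveInv S where
  inv_inv s := (eq_inv_of_inverse s⁻¹ s (inv_mul_self_mul_inv s) (mul_inv_mul_self s)).symm

theorem isIdempotentElem_mul_inv (s : S) : IsIdempotentElem (s * s⁻¹) := by
  rw [IsIdempotentElem, ← mul_assoc, mul_inv_mul_self]

theorem isIdempotentElem_inv_mul (s : S) : IsIdempotentElem (s⁻¹ * s) := by
  rw [IsIdempotentElem, ← mul_assoc, inv_mul_self_mul_inv]

namespace InverseSemigroup

protected theorem inv_eq_of_isIdempotentElem {e : S} (he : IsIdempotentElem e) : e⁻¹ = e :=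
  (eq_inv_of_inverse e e (by rw [he, he]) (by rw [he, he])).symm

/-- The inverse `z` of `e * f` is idempotent, because `f * z * e` is another inverse. -/
protected theorem isIdempotentElem_mul {e f : S} (he : IsIdempotentElem e)
    (hf : IsIdempotentElem f) : IsIdempotentElem (e * f) := by
  have he' : ∀ x, e * (e * x) = e * x := fun x => by rw [← mul_assoc, he]
  have hf' : ∀ x, f * (f * x) = f * x := fun x => by rw [← mul_assoc, hf]
  obtain ⟨z, hz⟩ : ∃ z, (e * f)⁻¹ = z := ⟨_, rfl⟩
  have hefz := mul_inv_mul_self (e * f)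
  have hzef := inv_mul_self_mul_inv (e * f)
  rw [hz] at hefz hzef
  have hfze : f * z * e = z := by
    refine (eq_inv_of_inverse (e * f) _ ?_ ?_).trans hz
    · simpa only [mul_assoc, he', hf'] using hefz
    · simpa only [mul_assoc, he', hf'] using congrArg (fun w => f * w * e) hzef
  have hzz : IsIdempotentElem z := by
    calc z * z = f * z * e * (f * z * e) := by rw [hfze]
      _ = f * (z * (e * f) * z) * e := by simp only [mul_assoc]
      _ = z := by rw [hzef, hfze]
  have hef : e * f = z := by
    rw [← inv_inv (e * f), hz, InverseSemigroup.inv_eq_of_isIdempotentElem hzz]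
  exact hef ▸ hzz

protected theorem commute_of_isIdempotentElem {e f : S} (he : IsIdempotentElem e)
    (hf : IsIdempotentElem f) : Commute e f := by
  have he' : ∀ x, e * (e * x) = e * x := fun x => by rw [← mul_assoc, he]
  have hf' : ∀ x, f * (f * x) = f * x := fun x => by rw [← mul_assoc, hf]
  have hef := InverseSemigroup.isIdempotentElem_mul he hf
  have hfe := InverseSemigroup.isIdempotentElem_mul hf he
  calc e * f = (e * f)⁻¹ := (InverseSemigroup.inv_eq_of_isIdempotentElem hef).symm
    _ = f * e := (eq_inv_of_inverse (e * f) (f * e)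
        (by simpa only [IsIdempotentElem, mul_assoc, he', hf'] using hef)
        (by simpa only [IsIdempotentElem, mul_assoc, he', hf'] using hfe)).symm

theorem mul_eq_self_of_isIdempotentElem {e c x : S} (he : IsIdempotentElem e)
    (h : c * (e * x) = x) : e * x = x := by
  have hf : x * x⁻¹ * x = x := mul_inv_mul_self x
  have hff := isIdempotentElem_mul_inv x
  have hcef : c * (e * (x * x⁻¹)) = x * x⁻¹ := by
    calc c * (e * (x * x⁻¹)) = c * (e * x) * x⁻¹ := by simp only [mul_assoc]
      _ = x * x⁻¹ := by rw [h]
  have hef : e * (x * x⁻¹) = x * x⁻¹ := by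
    calc e * (x * x⁻¹) = x * x⁻¹ * (e * (x * x⁻¹)) := by
          rw [(InverseSemigroup.commute_of_isIdempotentElem he hff).eq, ← mul_assoc (x * x⁻¹), hff]
      _ = c * (e * (x * x⁻¹) * (e * (x * x⁻¹))) := by rw [← mul_assoc c, hcef]
      _ = x * x⁻¹ := by rw [InverseSemigroup.isIdempotentElem_mul he hff, hcef]
  calc e * x = e * (x * x⁻¹) * x := by rw [mul_assoc, hf]
    _ = x := by rw [hef, hf]

end InverseSemigroup

theorem LRel.symm {s t : S} (h : LRel s t) : LRel t s := ⟨h.2, h.1⟩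

theorem LRel.trans {s t w : S} : LRel s t → LRel t w → LRel s w := by
  rintro ⟨⟨a, rfl⟩, a', ha⟩ ⟨⟨b, rfl⟩, b', hb⟩
  exact ⟨⟨b * a, mul_assoc b a s⟩, a' * b', by rw [mul_assoc a', hb, ha]⟩

theorem lRel_inv_mul_self (s : S) : LRel s (s⁻¹ * s) :=
  ⟨⟨s⁻¹, rfl⟩, s, by rw [← mul_assoc, mul_inv_mul_self]⟩

theorem LRel.refl (s : S) : LRel s s :=
  (lRel_inv_mul_self s).trans (lRel_inv_mul_self s).symm

theorem LRel.inv_mul_mul {w x : S} (h : LRel x (w * x)) : w⁻¹ * (w * x) = x := by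
  obtain ⟨-, b, hb⟩ := h
  rw [← mul_assoc]
  refine mul_eq_self_of_isIdempotentElem (c := b * w) (isIdempotentElem_inv_mul w) ?_
  calc b * w * (w⁻¹ * w * x) = b * (w * w⁻¹ * w * x) := by simp only [mul_assoc]
    _ = x := by rw [mul_inv_mul_self, hb]

theorem LRel.mul_eq_of_isIdempotentElem {e t : S} (he : IsIdempotentElem e) (h : LRel e t) :
    t * e = t := by
  obtain ⟨a, rfl⟩ := h.1
  rw [mul_assoc, he]

theorem InverseSubsemigroup.subset_closure (F : Set S) :
    F ⊆ (InverseSubsemigroup.closure F : Set S) :=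
  fun _ hx _ hT => hT hx

theorem InverseSubsemigroup.lRel_coe {T : InverseSubsemigroup S} {s t : T} (h : LRel s t) :
    LRel (s : S) t :=
  ⟨h.1.imp' (↑) fun _ => congrArg Subtype.val, h.2.imp' (↑) fun _ => congrArg Subtype.val⟩

variable [EMetricSpace S]

/-- With `e = p * p⁻¹` and `T` generated by `e` and the finite set that witnesses properness, the
Rips component of `p` lies in `{t * p | t ∈ T, e 𝓛 t}`. -/
theorem IsLocallyLFinite.hasFiniteRipsComponents (h : IsProper S) (hL : IsLocallyLFinite S) :
    HasFiniteRipsComponents S := by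
  intro r p
  obtain ⟨F, hF, hF'⟩ := h r
  let T := InverseSubsemigroup.closure (insert (p * p⁻¹) F)
  have hT : ∀ {f}, f ∈ insert (p * p⁻¹) F → f ∈ T := fun hf =>
    InverseSubsemigroup.subset_closure _ hf
  let e : T := ⟨p * p⁻¹, hT (Set.mem_insert _ _)⟩
  have he : IsIdempotentElem e := Subtype.ext (isIdempotentElem_mul_inv p)
  have hclosed : IsRipsClosed r ((fun t : T => (t : S) * p) '' {t | LRel e t}) := by
    rintro _ y hxy ⟨t, ht, rfl⟩
    obtain rfl | hne := eq_or_ne ((t : S) * p) y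
    · exact ⟨t, ht, rfl⟩
    obtain ⟨f, hf, rfl⟩ := hF' _ y hne hxy
    obtain ⟨g, hg, hgx⟩ := hF' _ _ hne.symm (edist_comm (t * p : S) _ ▸ hxy)
    let f' : T := ⟨f, hT (Set.mem_insert_of_mem _ hf)⟩
    let g' : T := ⟨g, hT (Set.mem_insert_of_mem _ hg)⟩
    have hte : t * e = t := ht.mul_eq_of_isIdempotentElem he
    have hgft : g' * (f' * t) = t := by
      rw [← hte]
      refine Subtype.ext (?_ : g * (f * (t * (p * p⁻¹))) = t * (p * p⁻¹))
      simpa only [mul_assoc] using congrArg (· * p⁻¹) hgx.symm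
    exact ⟨f' * t, ht.trans ⟨⟨f', rfl⟩, g', hgft⟩, mul_assoc f (t : S) p⟩
  refine ((hL T ⟨_, hF.insert _, rfl⟩ e).image fun t : T => (t : S) * p).subset fun y hy => ?_
  exact hclosed.mem_of_reachable ⟨e, .refl e, mul_inv_mul_self p⟩ hy

/-- The elements that move each point `x` within its Rips component whenever they move it within
its `𝓛`-class. -/
def ripsStabilizer (S : Type u) [InverseSemigroup S] [EMetricSpace S] (r : ℝ≥0) :
    InverseSubsemigroup S where
  carrier := {w | ∀ x, LRel x (w * x) → (ripsGraph S r).Reachable x (w * x)}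
  mul_mem' {a b} ha hb x hx := by
    obtain ⟨-, c, hc⟩ := hx
    have hxb : LRel x (b * x) := ⟨⟨b, rfl⟩, c * a, by simpa only [mul_assoc] using hc⟩
    have hba : LRel (b * x) (a * (b * x)) :=
      ⟨⟨a, rfl⟩, b * c, by rw [← mul_assoc a, mul_assoc b, hc]⟩
    exact mul_assoc a b x ▸ (hb x hxb).trans (ha _ hba)
  inv_mem' {a} ha x hx := by
    have hax : a * (a⁻¹ * x) = x := by simpa only [inv_inv] using hx.inv_mul_mul
    simpa only [hax] using (ha (a⁻¹ * x) (by rw [hax]; exact hx.symm)).symm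

theorem IsRightSubinvariant.mem_ripsStabilizer (h : IsRightSubinvariant S) {r : ℝ≥0} {w : S}
    (hw : edist w (w⁻¹ * w) ≤ r) : w ∈ ripsStabilizer S r := by
  intro x hx
  refine (reachable_of_edist_le ?_).symm
  calc edist (w * x) x = edist (w * x) (w⁻¹ * w * x) := by rw [mul_assoc, hx.inv_mul_mul]
    _ ≤ edist w (w⁻¹ * w) := h _ _ _
    _ ≤ r := hw

theorem HasFiniteRipsComponents.isLocallyLFinite (hfin : ∀ x y : S, LRel x y → edist x y < ∞)
    (h : IsRightSubinvariant S) (hC : HasFiniteRipsComponents S) : IsLocallyLFinite S := by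
  rintro _ ⟨F, hF, rfl⟩ s
  obtain ⟨r, hr⟩ := exists_nnreal_forall_le_of_finite hF (f := fun f => edist f (f⁻¹ * f))
    fun f _ => hfin _ _ (lRel_inv_mul_self f)
  refine ((hC r s).preimage Subtype.val_injective.injOn).subset fun t ht => ?_
  obtain ⟨a, rfl⟩ := ht.1
  have ha : (a : S) ∈ ripsStabilizer S r := a.2 _ fun f hf => h.mem_ripsStabilizer (hr f hf)
  exact ha s (InverseSubsemigroup.lRel_coe ht)

end InverseSemigroup

/-! ### Quasi-diagonality of the uniform Roe algebra -/

section EllTwo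

variable {X : Type u}

theorem delta_apply_self (x : X) : delta x x = 1 := by
  classical
  exact lp.single_apply_self (E := fun _ : X => ℂ) 2 x 1

theorem delta_apply_ne {x y : X} (h : y ≠ x) : delta x y = 0 := by
  classical
  exact lp.single_apply_ne (E := fun _ : X => ℂ) 2 x 1 h

theorem inner_delta_left (x : X) (u : EllTwo X) : inner ℂ (delta x) u = u x := by
  classical
  exact (lp.inner_single_left (𝕜 := ℂ) (G := fun _ : X => ℂ) x 1 u).trans (by simp)

theorem inner_delta_right (x : X) (u : EllTwo X) : inner ℂ u (delta x) = star (u x) := by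
  rw [← inner_delta_left, ← inner_conj_symm, starRingEnd_apply]

theorem orthonormal_delta : Orthonormal ℂ (delta : X → EllTwo X) := by
  classical
  rw [orthonormal_iff_ite]
  intro x y
  rw [inner_delta_left]
  split_ifs with h
  · rw [h, delta_apply_self]
  · exact delta_apply_ne h

theorem hasSum_smul_delta (u : EllTwo X) : HasSum (fun x => u x • delta x) u := by
  classical
  refine (lp.hasSum_single (p := 2) (by simp) u).congr_fun fun x =>
    (?_ : _ = lp.single (E := fun _ : X => ℂ) 2 x (u x))
  rw [delta, ← lp.single_smul, smul_eq_mul, mul_one]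

/-- The vectors of `ℓ²(X)` that are supported on the finite set `Y`. -/
noncomputable def coordSubspace (Y : Finset X) : Submodule ℂ (EllTwo X) :=
  Submodule.span ℂ (delta '' Y)

instance (Y : Finset X) : FiniteDimensional ℂ (coordSubspace Y) :=
  FiniteDimensional.span_of_finite ℂ (Y.finite_toSet.image _)

theorem sum_smul_delta_mem_coordSubspace (Y : Finset X) (a : X → ℂ) :
    ∑ x ∈ Y, a x • delta x ∈ coordSubspace Y :=
  Submodule.sum_mem _ fun _ hx =>
    Submodule.smul_mem _ _ (Submodule.subset_span (Set.mem_image_of_mem _ hx))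

theorem coordSubspace_mono {Y Z : Finset X} (h : Y ⊆ Z) : coordSubspace Y ≤ coordSubspace Z :=
  Submodule.span_mono (Set.image_mono h)

theorem mem_coordSubspace_of_apply_eq_zero {Y : Finset X} {u : EllTwo X}
    (h : ∀ x ∉ Y, u x = 0) : u ∈ coordSubspace Y := by
  have hsum : ∑ x ∈ Y, u x • delta x = u :=
    (hasSum_sum_of_ne_finset_zero fun x hx => by rw [h x hx, zero_smul]).unique
      (hasSum_smul_delta u)
  exact hsum ▸ sum_smul_delta_mem_coordSubspace Y _

/-- The orthogonal projection of `ℓ²(X)` onto the vectors supported on `Y`. -/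
noncomputable def coordProj (Y : Finset X) : EllTwo X →L[ℂ] EllTwo X :=
  (coordSubspace Y).starProjection

theorem isStarProjection_coordProj (Y : Finset X) : IsStarProjection (coordProj Y) :=
  isStarProjection_starProjection

theorem range_coordProj (Y : Finset X) :
    LinearMap.range (coordProj Y : EllTwo X →ₗ[ℂ] EllTwo X) = coordSubspace Y :=
  Submodule.range_starProjection _

theorem exists_forall_norm_coordProj_sub_le (v : EllTwo X) {ε : ℝ} (hε : 0 < ε) :
    ∃ Z : Finset X, ∀ Y : Finset X, Z ⊆ Y → ‖coordProj Y v - v‖ ≤ ε := by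
  obtain ⟨Z, hZ⟩ := ((hasSum_smul_delta v).eventually (Metric.ball_mem_nhds v hε)).exists
  refine ⟨Z, fun Y hZY => ?_⟩
  have hmem := coordSubspace_mono hZY (sum_smul_delta_mem_coordSubspace Z v)
  rw [norm_sub_rev, coordProj, Submodule.starProjection_minimal]
  refine (ciInf_le ⟨0, Set.forall_mem_range.2 fun _ => norm_nonneg _⟩ ⟨_, hmem⟩).trans ?_
  rw [← dist_eq_norm, dist_comm]
  exact (Metric.mem_ball.1 hZ).le

end EllTwo

section Commutator

open Module.End in
theorem commute_starProjection {H : Type*} [NormedAddCommGroup H] [InnerProductSpace ℂ H]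
    [CompleteSpace H] {K : Submodule ℂ H} [K.HasOrthogonalProjection] {t : H →L[ℂ] H}
    (h : K ∈ invtSubmodule t.toLinearMap) (h' : K ∈ invtSubmodule (star t).toLinearMap) :
    Commute K.starProjection t := by
  have hidem : IsIdempotentElem K.starProjection := K.isIdempotentElem_starProjection
  rw [ContinuousLinearMap.IsIdempotentElem.commute_iff hidem, Submodule.range_starProjection,
    Submodule.ker_starProjection]
  exact ⟨h, ContinuousLinearMap.orthogonal_mem_invtSubmodule h'⟩

theorem norm_commutator_le_of_commute {A : Type*} [NonUnitalSeminormedRing A] {p s t : A}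
    {ε : ℝ} (hp : ‖p‖ ≤ 1) (hs : Commute p s) (hst : ‖t - s‖ ≤ ε / 2) :
    ‖p * t - t * p‖ ≤ ε := by
  have heq : p * t - t * p = p * (t - s) - (t - s) * p := by
    rw [mul_sub, sub_mul, hs.eq]
    abel
  calc ‖p * t - t * p‖ ≤ ‖p * (t - s)‖ + ‖(t - s) * p‖ := heq ▸ norm_sub_le _ _
    _ ≤ ‖p‖ * ‖t - s‖ + ‖t - s‖ * ‖p‖ := add_le_add (norm_mul_le _ _) (norm_mul_le _ _)
    _ ≤ 1 * (ε / 2) + ε / 2 * 1 := by gcongr; exact (norm_nonneg _).trans hst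
    _ = ε := by ring

end Commutator

section Roe

variable {X : Type u} [EMetricSpace X]

/-- The matrix coefficients of `t` are supported on the pairs of points at distance at most
`r`. -/
def HasPropagationLE (r : ℝ≥0) (t : EllTwo X →L[ℂ] EllTwo X) : Prop :=
  ∀ x y : X, (r : ℝ≥0∞) < edist x y → inner ℂ (t (delta x)) (delta y) = 0

theorem HasPropagationLE.star {r : ℝ≥0} {t : EllTwo X →L[ℂ] EllTwo X}
    (h : HasPropagationLE r t) : HasPropagationLE r (star t) := by
  intro x y hxy
  rw [ContinuousLinearMap.star_eq_adjoint, ContinuousLinearMap.adjoint_inner_left,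
    ← inner_conj_symm, h y x (edist_comm x y ▸ hxy), map_zero]

theorem HasPropagationLE.mem_uniformRoeAlgebra {r : ℝ≥0} {t : EllTwo X →L[ℂ] EllTwo X}
    (h : HasPropagationLE r t) : t ∈ uniformRoeAlgebra X :=
  StarSubalgebra.le_topologicalClosure _ (StarAlgebra.subset_adjoin ℂ _ ⟨r, h⟩)

theorem HasPropagationLE.coordSubspace_mem_invtSubmodule {r : ℝ≥0} {t : EllTwo X →L[ℂ] EllTwo X}
    (h : HasPropagationLE r t) {Y : Finset X} (hY : IsRipsClosed r (Y : Set X)) :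
    coordSubspace Y ∈ Module.End.invtSubmodule t.toLinearMap := by
  refine Submodule.span_le.2 ?_
  rintro _ ⟨x, hx, rfl⟩
  refine mem_coordSubspace_of_apply_eq_zero fun y hy => ?_
  have hxy : (r : ℝ≥0∞) < edist x y := not_le.1 fun hle => hy (hY hle hx)
  have hcoeff := h x y hxy
  rwa [inner_delta_right, star_eq_zero] at hcoeff

theorem exists_forall_commute_coordProj {t : EllTwo X →L[ℂ] EllTwo X}
    (ht : t ∈ StarAlgebra.adjoin ℂ {t : EllTwo X →L[ℂ] EllTwo X | HasFinitePropagation t}) :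
    ∃ r : ℝ≥0, ∀ Y : Finset X, IsRipsClosed r (Y : Set X) → Commute (coordProj Y) t := by
  induction ht using StarAlgebra.adjoin_induction with
  | mem t ht =>
    obtain ⟨r, hr : HasPropagationLE r t⟩ := ht
    exact ⟨r, fun Y hY => commute_starProjection (hr.coordSubspace_mem_invtSubmodule hY)
      (hr.star.coordSubspace_mem_invtSubmodule hY)⟩
  | algebraMap c => exact ⟨0, fun Y _ => (Algebra.commutes c _).symm⟩
  | add a b _ _ ha hb =>
    obtain ⟨r, hr⟩ := ha
    obtain ⟨r', hr'⟩ := hb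
    exact ⟨max r r', fun Y hY =>
      (hr Y (hY.anti (le_max_left _ _))).add_right (hr' Y (hY.anti (le_max_right _ _)))⟩
  | mul a b _ _ ha hb =>
    obtain ⟨r, hr⟩ := ha
    obtain ⟨r', hr'⟩ := hb
    exact ⟨max r r', fun Y hY =>
      (hr Y (hY.anti (le_max_left _ _))).mul_right (hr' Y (hY.anti (le_max_right _ _)))⟩
  | star a _ ha =>
    obtain ⟨r, hr⟩ := ha
    refine ⟨r, fun Y hY => ?_⟩
    simpa only [(isStarProjection_coordProj Y).isSelfAdjoint.star_eq] using (hr Y hY).star_star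

theorem exists_forall_norm_commutator_coordProj_le {t : EllTwo X →L[ℂ] EllTwo X}
    (ht : t ∈ uniformRoeAlgebra X) {ε : ℝ} (hε : 0 < ε) :
    ∃ r : ℝ≥0, ∀ Y : Finset X, IsRipsClosed r (Y : Set X) →
      ‖coordProj Y * t - t * coordProj Y‖ ≤ ε := by
  obtain ⟨s, hs, hts⟩ := Metric.mem_closure_iff.1 ht (ε / 2) (half_pos hε)
  obtain ⟨r, hr⟩ := exists_forall_commute_coordProj hs
  rw [dist_eq_norm] at hts
  exact ⟨r, fun Y hY => norm_commutator_le_of_commute (Submodule.starProjection_norm_le _)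
    (hr Y hY) hts.le⟩

theorem HasFiniteRipsComponents.isQuasidiagonal (hC : HasFiniteRipsComponents X) :
    IsQuasidiagonal (uniformRoeAlgebra X) := by
  refine ⟨EllTwo X, inferInstance, inferInstance, inferInstance,
    (uniformRoeAlgebra X).subtype, Subtype.val_injective, fun F hF hFfin ε hε V hV => ?_⟩
  have hcomm : ∀ t ∈ F, ∃ r : ℝ≥0, ∀ Y : Finset X, IsRipsClosed r (Y : Set X) →
      ‖coordProj Y * t - t * coordProj Y‖ ≤ ε := fun t ht => by
    obtain ⟨a, rfl⟩ := hF ht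
    exact exists_forall_norm_commutator_coordProj_le a.2 hε
  choose! r hr using hcomm
  choose Z hZ using fun v : EllTwo X => exists_forall_norm_coordProj_sub_le v hε
  obtain ⟨R, hR⟩ := (hFfin.image r).bddAbove
  have hfin : (ripsHull R (⋃ v ∈ V, (Z v : Set X))).Finite :=
    hC.finite_ripsHull R (hV.biUnion fun v _ => (Z v).finite_toSet)
  refine ⟨coordProj hfin.toFinset, isStarProjection_coordProj _,
    range_coordProj hfin.toFinset ▸ inferInstance, fun t ht => hr t ht _ ?_, fun v hv => hZ v _ ?_⟩
  · rw [hfin.coe_toFinset]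
    exact (isRipsClosed_ripsHull R _).anti (hR ⟨t, ht, rfl⟩)
  · intro x hx
    exact hfin.mem_toFinset.2 (subset_ripsHull _ _ (Set.mem_biUnion hv hx))

end Roe

/-! ### Infinite Rips components give proper isometries -/

section RayShift

variable {X : Type*} {f : ℕ → X}

/-- The self-map of `X` that moves each point of the ray `f` to the next one and fixes all other
points. -/
noncomputable def rayShift (f : ℕ → X) : X → X :=
  Function.extend f (fun n => f (n + 1)) id

theorem rayShift_apply (hf : Function.Injective f) (n : ℕ) : rayShift f (f n) = f (n + 1) :=
  hf.extend_apply _ _ n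

theorem rayShift_of_notMem_range {x : X} (hx : x ∉ Set.range f) : rayShift f x = x :=
  Function.extend_apply' _ _ x hx

theorem rayShift_mem_range_iff (hf : Function.Injective f) {x : X} :
    rayShift f x ∈ Set.range f ↔ x ∈ Set.range f := by
  by_cases hx : x ∈ Set.range f
  · obtain ⟨n, rfl⟩ := hx
    simp [rayShift_apply hf]
  · rw [rayShift_of_notMem_range hx]

theorem rayShift_injective (hf : Function.Injective f) : Function.Injective (rayShift f) := by
  intro x y hxy
  by_cases hx : x ∈ Set.range f
  · have hy : y ∈ Set.range f := by rwa [← rayShift_mem_range_iff hf, ← hxy,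
      rayShift_mem_range_iff hf]
    exact hf.extend_injOn (hf.comp Nat.succ_injective) hx hy hxy
  · have hy : y ∉ Set.range f := by rwa [← rayShift_mem_range_iff hf, ← hxy,
      rayShift_mem_range_iff hf]
    rwa [rayShift_of_notMem_range hx, rayShift_of_notMem_range hy] at hxy

theorem rayShift_ne (hf : Function.Injective f) (x : X) : rayShift f x ≠ f 0 := by
  intro h
  obtain ⟨n, rfl⟩ := (rayShift_mem_range_iff hf).1 ⟨0, h.symm⟩
  rw [rayShift_apply hf] at h
  exact n.succ_ne_zero (hf h)

end RayShift

section DeltaMap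

variable {X : Type u} {φ : X → X}

/-- The isometry of `ℓ²(X)` with `δ_x ↦ δ_{φ x}`. -/
noncomputable def deltaMap (hφ : Function.Injective φ) : EllTwo X →ₗᵢ[ℂ] EllTwo X :=
  (orthonormal_delta.comp φ hφ).orthogonalFamily.linearIsometry

theorem deltaMap_delta (hφ : Function.Injective φ) (x : X) :
    deltaMap hφ (delta x) = delta (φ x) := by
  classical
  refine ((orthonormal_delta.comp φ hφ).orthogonalFamily.linearIsometry_apply_single
    (i := x) (1 : ℂ)).trans ?_
  simp

theorem star_deltaMap_delta_eq_zero (hφ : Function.Injective φ) {z : X} (hz : z ∉ Set.range φ) :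
    star (deltaMap hφ).toContinuousLinearMap (delta z) = 0 := by
  ext x
  rw [← inner_delta_left, ContinuousLinearMap.star_eq_adjoint,
    ContinuousLinearMap.adjoint_inner_right, LinearIsometry.coe_toContinuousLinearMap,
    deltaMap_delta, inner_delta_left]
  exact delta_apply_ne fun h => hz ⟨x, h⟩

variable [EMetricSpace X]

theorem hasPropagationLE_deltaMap (hφ : Function.Injective φ) {r : ℝ≥0}
    (hr : ∀ x, edist x (φ x) ≤ r) : HasPropagationLE r (deltaMap hφ).toContinuousLinearMap := by
  intro x y hxy
  rw [LinearIsometry.coe_toContinuousLinearMap, deltaMap_delta, inner_delta_left]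
  exact delta_apply_ne fun h => hxy.not_ge (h ▸ hr x)

theorem surjective_of_isFiniteAlg (h : IsFiniteAlg (uniformRoeAlgebra X))
    (hφ : Function.Injective φ) {r : ℝ≥0} (hr : ∀ x, edist x (φ x) ≤ r) :
    Function.Surjective φ := by
  intro z
  by_contra hz
  let v := (deltaMap hφ).toContinuousLinearMap
  have hv : v ∈ uniformRoeAlgebra X := (hasPropagationLE_deltaMap hφ hr).mem_uniformRoeAlgebra
  have hvv : star v * v = 1 := v.norm_map_iff_adjoint_comp_self.1 (deltaMap hφ).norm_map
  refine h ⟨⟨v, hv⟩, Subtype.ext hvv, fun hcoisometry => orthonormal_delta.ne_zero (𝕜 := ℂ) z ?_⟩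
  have hvv' : v * star v = 1 := congrArg Subtype.val hcoisometry
  calc delta z = (v * star v) (delta z) := by rw [hvv']; rfl
    _ = v (star v (delta z)) := rfl
    _ = 0 := by rw [star_deltaMap_delta_eq_zero hφ hz, map_zero]

theorem hasFiniteRipsComponents_of_isFiniteAlg (hb : HasFiniteBalls X)
    (h : IsFiniteAlg (uniformRoeAlgebra X)) : HasFiniteRipsComponents X := by
  intro r p
  by_contra hinf
  obtain ⟨f, hf, hadj⟩ := exists_ray (G := ripsGraph X r)
    (fun x => (hb r x).subset fun y hy => hy.2) hinf
  have hdist : ∀ x, edist x (rayShift f x) ≤ r := fun x => by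
    by_cases hx : x ∈ Set.range f
    · obtain ⟨n, rfl⟩ := hx
      exact rayShift_apply hf n ▸ (hadj n).2
    · simp [rayShift_of_notMem_range hx]
  obtain ⟨x, hx⟩ := surjective_of_isFiniteAlg h (rayShift_injective hf) hdist (f 0)
  exact rayShift_ne hf x hx

end DeltaMap

/-! ### Quasi-diagonality and stable finiteness -/

section AlmostCommuting

variable {H : Type*} [NormedAddCommGroup H] [InnerProductSpace ℂ H] [CompleteSpace H]
  {p v : H →L[ℂ] H} {δ : ℝ}

theorem norm_apply_of_star_mul_self_eq_one (hv : star v * v = 1) (x : H) : ‖v x‖ = ‖x‖ :=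
  v.norm_map_iff_adjoint_comp_self.2 hv x

theorem norm_le_two_mul_norm_compression (hv : star v * v = 1) (hδ : δ ≤ 1 / 2)
    (hpv : ‖p * v - v * p‖ ≤ δ) {x : H} (hx : p x = x) : ‖x‖ ≤ 2 * ‖p (v x)‖ := by
  have hcomm : ‖(p * v - v * p) x‖ ≤ 1 / 2 * ‖x‖ :=
    ContinuousLinearMap.le_of_opNorm_le _ (hpv.trans hδ) x
  have hvx : v x = p (v x) - (p * v - v * p) x := by
    simp only [sub_apply, mul_apply_eq_comp, hx, sub_sub_cancel]
  have htri : ‖x‖ ≤ ‖p (v x)‖ + ‖(p * v - v * p) x‖ := by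
    rw [← norm_apply_of_star_mul_self_eq_one hv x]
    nth_rw 1 [hvx]
    exact norm_sub_le _ _
  linarith

theorem exists_compression_eq (hv : star v * v = 1) (hp : IsIdempotentElem p)
    [FiniteDimensional ℂ (LinearMap.range (p : H →ₗ[ℂ] H))] (hδ : δ ≤ 1 / 2)
    (hpv : ‖p * v - v * p‖ ≤ δ) (w : H) : ∃ x, p x = x ∧ p (v x) = p w := by
  let W := LinearMap.range (p : H →ₗ[ℂ] H)
  have hfix : ∀ x ∈ W, p x = x := by
    rintro _ ⟨y, rfl⟩
    exact congrArg (fun t : H →L[ℂ] H => t y) hp.eq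
  let a : W →ₗ[ℂ] W := ((p : H →ₗ[ℂ] H).rangeRestrict ∘ₗ (v : H →ₗ[ℂ] H)) ∘ₗ W.subtype
  have ha : Function.Injective a := by
    refine (injective_iff_map_eq_zero a).2 fun x hax => Subtype.ext (norm_le_zero_iff.1 ?_)
    have hpvx : p (v x) = 0 := congrArg Subtype.val hax
    simpa [hpvx] using norm_le_two_mul_norm_compression hv hδ hpv (hfix x x.2)
  obtain ⟨x, hx⟩ := LinearMap.surjective_of_injective ha ⟨p w, w, rfl⟩
  exact ⟨x, hfix x x.2, congrArg Subtype.val hx⟩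

/-- The compression of `v` to the range of `p` is onto, so that `p w = p (v x)` for some `x`;
then `v x` is close to `w`, although it is orthogonal to `w`. -/
theorem norm_le_of_star_apply_eq_zero (hv : star v * v = 1) (hp : IsStarProjection p)
    [FiniteDimensional ℂ (LinearMap.range (p : H →ₗ[ℂ] H))] (hδ : δ ≤ 1 / 2)
    (hpv : ‖p * v - v * p‖ ≤ δ) {w : H} (hw : star v w = 0) (hpw : ‖p w - w‖ ≤ δ) :
    ‖w‖ ≤ δ * (1 + 2 * ‖w‖) := by
  have : 0 ≤ δ := (norm_nonneg _).trans hpv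
  obtain ⟨x, hpx, hpvx⟩ := exists_compression_eq hv hp.isIdempotentElem hδ hpv w
  have hx : ‖x‖ ≤ 2 * ‖w‖ := calc
    ‖x‖ ≤ 2 * ‖p w‖ := hpvx ▸ norm_le_two_mul_norm_compression hv hδ hpv hpx
    _ ≤ 2 * ‖w‖ := by
      gcongr
      exact (p.le_of_opNorm_le hp.norm_le w).trans_eq (one_mul _)
  have horth : inner ℂ w (v x) = 0 := by
    rw [← ContinuousLinearMap.adjoint_inner_left, ← ContinuousLinearMap.star_eq_adjoint, hw,
      inner_zero_left]
  have hle : ‖w‖ ≤ ‖v x - w‖ := by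
    have hpyth := norm_add_sq_eq_norm_sq_add_norm_sq_of_inner_eq_zero (𝕜 := ℂ) w (-v x)
      (by rw [inner_neg_right, horth, neg_zero])
    rw [norm_sub_rev, sub_eq_add_neg]
    nlinarith [norm_nonneg (w + -v x), mul_self_nonneg ‖-v x‖]
  calc ‖w‖ ≤ ‖(p w - w) - (p * v - v * p) x‖ := by
        simpa only [sub_apply, mul_apply_eq_comp, hpx, hpvx, sub_sub_sub_cancel_left]
          using hle
    _ ≤ ‖p w - w‖ + ‖(p * v - v * p) x‖ := norm_sub_le _ _
    _ ≤ δ + δ * (2 * ‖w‖) := by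
      gcongr
      exact ContinuousLinearMap.le_of_opNorm_le_of_le _ hpv hx
    _ = δ * (1 + 2 * ‖w‖) := by ring

end AlmostCommuting

theorem IsQuasidiagonalSet.mul_star_self_eq_one {H : Type u} [NormedAddCommGroup H]
    [InnerProductSpace ℂ H] [CompleteSpace H] {Ω : Set (H →L[ℂ] H)} (h : IsQuasidiagonalSet Ω)
    {v : H →L[ℂ] H} (hvΩ : v ∈ Ω) (hv : star v * v = 1) : v * star v = 1 := by
  ext y
  let w := y - v (star v y)
  have hw : star v w = 0 := by
    have hvv : ∀ z, star v (v z) = z := fun z => congrArg (fun t : H →L[ℂ] H => t z) hv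
    rw [map_sub, hvv, sub_self]
  suffices hw0 : w = 0 from (sub_eq_zero.1 hw0).symm
  by_contra hw0
  have hwpos : 0 < ‖w‖ := norm_pos_iff.2 hw0
  let δ := min (1 / 2) (‖w‖ / (2 * (1 + 2 * ‖w‖)))
  obtain ⟨p, hp, hpfin, hpv, hpw⟩ := h {v} (Set.singleton_subset_iff.2 hvΩ) (Set.finite_singleton v)
    δ (by positivity) {w} (Set.finite_singleton w)
  have hle : ‖w‖ ≤ δ * (1 + 2 * ‖w‖) := norm_le_of_star_apply_eq_zero hv hp
    (min_le_left _ _) (hpv v rfl) hw (hpw w rfl)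
  have hδ : δ * (2 * (1 + 2 * ‖w‖)) ≤ ‖w‖ :=
    (le_div_iff₀ (by positivity)).1 (min_le_right _ _)
  linarith

theorem IsQuasidiagonal.isFiniteAlg {A : Type u} [Ring A] [StarRing A] [Algebra ℂ A]
    (h : IsQuasidiagonal A) : IsFiniteAlg A := by
  obtain ⟨H, _, _, _, π, hπ, hQ⟩ := h
  rintro ⟨v, hv, hv'⟩
  refine hv' (hπ ?_)
  rw [map_mul, map_star, map_one]
  refine hQ.mul_star_self_eq_one ⟨v, rfl⟩ ?_
  rw [← map_star, ← map_mul, hv, map_one]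

theorem norm_le_sum_norm_apply {ι H : Type*} [Fintype ι] [SeminormedAddCommGroup H]
    (x : PiLp 2 (fun _ : ι => H)) : ‖x‖ ≤ ∑ i, ‖x i‖ := by
  rw [PiLp.norm_eq_of_L2]
  exact Real.sqrt_le_iff.2
    ⟨by positivity, Finset.sum_sq_le_sq_sum_of_nonneg fun i _ => norm_nonneg _⟩

section MatrixOperator

variable {ι : Type*} [Fintype ι] {H : Type*} [NormedAddCommGroup H] [InnerProductSpace ℂ H]

/-- The operator on the Hilbert space of column vectors with entries in `H` that is given by a
matrix of operators on `H`. -/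
noncomputable def matrixOperator (M : Matrix ι ι (H →L[ℂ] H)) :
    PiLp 2 (fun _ : ι => H) →L[ℂ] PiLp 2 (fun _ : ι => H) :=
  (PiLp.continuousLinearEquiv 2 ℂ fun _ : ι => H).symm.toContinuousLinearMap ∘L
    ContinuousLinearMap.pi fun i => ∑ j, M i j ∘L PiLp.proj 2 (fun _ : ι => H) j

theorem matrixOperator_apply (M : Matrix ι ι (H →L[ℂ] H)) (x : PiLp 2 (fun _ : ι => H)) (i : ι) :
    matrixOperator M x i = ∑ j, M i j (x j) := by
  simp [matrixOperator]

theorem norm_matrixOperator_le (M : Matrix ι ι (H →L[ℂ] H)) :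
    ‖matrixOperator M‖ ≤ ∑ i, ∑ j, ‖M i j‖ := by
  refine ContinuousLinearMap.opNorm_le_bound _ (by positivity) fun x => ?_
  calc ‖matrixOperator M x‖ ≤ ∑ i, ‖matrixOperator M x i‖ := norm_le_sum_norm_apply _
    _ ≤ ∑ i, ∑ j, ‖M i j‖ * ‖x‖ := by
        gcongr with i
        rw [matrixOperator_apply]
        exact norm_sum_le_of_le _ fun j _ =>
          (M i j).le_opNorm_of_le (PiLp.norm_apply_le x j)
    _ = (∑ i, ∑ j, ‖M i j‖) * ‖x‖ := by simp only [Finset.sum_mul]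

theorem matrixOperator_mul (M N : Matrix ι ι (H →L[ℂ] H)) :
    matrixOperator (M * N) = matrixOperator M * matrixOperator N := by
  ext x i
  simp only [mul_apply_eq_comp, matrixOperator_apply, Matrix.mul_apply, map_sum,
    sum_apply]
  exact Finset.sum_comm

theorem matrixOperator_star [CompleteSpace H] (M : Matrix ι ι (H →L[ℂ] H)) :
    matrixOperator (star M) = star (matrixOperator M) := by
  refine (ContinuousLinearMap.eq_adjoint_iff _ _).2 fun x y => ?_
  simp only [PiLp.inner_apply, matrixOperator_apply, sum_inner, inner_sum, Matrix.star_apply,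
    ContinuousLinearMap.star_eq_adjoint, ContinuousLinearMap.adjoint_inner_left]
  exact Finset.sum_comm

theorem matrixOperator_injective :
    Function.Injective (matrixOperator : Matrix ι ι (H →L[ℂ] H) → _) := by
  classical
  intro M N h
  ext i j v
  have hcol : ∀ L : Matrix ι ι (H →L[ℂ] H), matrixOperator L (PiLp.single 2 j v) i = L i j v :=
    fun L => by
      rw [matrixOperator_apply, Finset.sum_eq_single j] <;> simp +contextual
  rw [← hcol M, ← hcol N, h]

variable [DecidableEq ι]

theorem matrixOperator_diagonal_apply (p : H →L[ℂ] H) (x : PiLp 2 (fun _ : ι => H)) (i : ι) :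
    matrixOperator (Matrix.diagonal fun _ => p) x i = p (x i) := by
  rw [matrixOperator_apply, Finset.sum_eq_single i] <;>
    simp +contextual [Matrix.diagonal_apply_ne, eq_comm]

variable [CompleteSpace H]

/-- The representation of the matrix algebra over the bounded operators on `H` by operators on
the column vectors with entries in `H`. -/
noncomputable def matrixOperatorHom :
    Matrix ι ι (H →L[ℂ] H) →⋆ₐ[ℂ] (PiLp 2 (fun _ : ι => H) →L[ℂ] PiLp 2 (fun _ : ι => H)) where
  toFun := matrixOperator
  map_one' := by
    ext x i
    exact matrixOperator_diagonal_apply 1 x i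
  map_mul' := matrixOperator_mul
  map_zero' := by
    ext x i
    simp [matrixOperator_apply]
  map_add' M N := by
    ext x i
    simp [matrixOperator_apply, Finset.sum_add_distrib]
  commutes' c := by
    ext x i
    exact matrixOperator_diagonal_apply (algebraMap ℂ (H →L[ℂ] H) c) x i
  map_star' := matrixOperator_star

end MatrixOperator

section MatrixQuasidiagonal

variable {ι : Type} [Fintype ι] [DecidableEq ι]

theorem finiteDimensional_range_matrixOperator_diagonal {H : Type*} [NormedAddCommGroup H]
    [InnerProductSpace ℂ H] (p : H →L[ℂ] H)
    [FiniteDimensional ℂ (LinearMap.range (p : H →ₗ[ℂ] H))] :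
    FiniteDimensional ℂ (LinearMap.range (matrixOperator (Matrix.diagonal fun _ : ι => p) :
      PiLp 2 (fun _ : ι => H) →ₗ[ℂ] PiLp 2 (fun _ : ι => H))) := by
  let columns := (WithLp.linearEquiv 2 ℂ (ι → H)).symm.toLinearMap ∘ₗ
    LinearMap.piMap fun _ => (LinearMap.range (p : H →ₗ[ℂ] H)).subtype
  refine Submodule.finiteDimensional_of_le (S₂ := LinearMap.range columns) ?_
  rintro _ ⟨x, rfl⟩
  refine ⟨fun i => ⟨p (x i), x i, rfl⟩, ?_⟩
  ext i
  exact (matrixOperator_diagonal_apply p x i).symm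

theorem norm_commutator_matrixOperator_diagonal_le {H : Type*} [NormedAddCommGroup H]
    [InnerProductSpace ℂ H] (p : H →L[ℂ] H) (M : Matrix ι ι (H →L[ℂ] H)) :
    ‖matrixOperator (Matrix.diagonal fun _ => p) * matrixOperator M -
        matrixOperator M * matrixOperator (Matrix.diagonal fun _ => p)‖ ≤
      ∑ i, ∑ j, ‖p * M i j - M i j * p‖ := by
  have heq : matrixOperator (Matrix.diagonal fun _ => p) * matrixOperator M -
      matrixOperator M * matrixOperator (Matrix.diagonal fun _ => p) =
      matrixOperator (Matrix.of fun i j => p * M i j - M i j * p) := by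
    ext x i
    simp only [sub_apply, mul_apply_eq_comp, PiLp.sub_apply, matrixOperator_diagonal_apply,
      matrixOperator_apply M, matrixOperator_apply (Matrix.of _), Matrix.of_apply, map_sum,
      Finset.sum_sub_distrib]
  exact heq ▸ norm_matrixOperator_le _

theorem isStarProjection_matrixOperator_diagonal {H : Type*} [NormedAddCommGroup H]
    [InnerProductSpace ℂ H] [CompleteSpace H] {p : H →L[ℂ] H} (hp : IsStarProjection p) :
    IsStarProjection (matrixOperator (Matrix.diagonal fun _ : ι => p)) := by
  have hdiag : IsStarProjection (Matrix.diagonal fun _ : ι => p) :=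
    ⟨by rw [IsIdempotentElem, Matrix.diagonal_mul_diagonal, hp.isIdempotentElem.eq],
      (Matrix.diagonal_conjTranspose _).trans
        (congrArg Matrix.diagonal (funext fun _ => hp.isSelfAdjoint.star_eq))⟩
  exact hdiag.map (matrixOperatorHom (ι := ι) (H := H))

omit [DecidableEq ι] in
theorem IsQuasidiagonalSet.image_matrixOperator {H : Type u} [NormedAddCommGroup H]
    [InnerProductSpace ℂ H] [CompleteSpace H] {Ω : Set (H →L[ℂ] H)} (h : IsQuasidiagonalSet Ω) :
    IsQuasidiagonalSet (matrixOperator '' (Ω.matrix : Set (Matrix ι ι (H →L[ℂ] H)))) := by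
  classical
  intro F hF hFfin ε hε V hV
  obtain ⟨F, hFΩ, rfl⟩ := Set.subset_image_iff.1 hF
  replace hFfin : F.Finite := hFfin.of_finite_image matrixOperator_injective.injOn
  let n : ℝ := Fintype.card ι
  let δ : ℝ := ε / (n ^ 2 + 1)
  have hδ : (n ^ 2 + 1) * δ = ε := mul_div_cancel₀ _ (by positivity)
  have hδ0 : 0 < δ := by positivity
  obtain ⟨p, hp, hpfin, hpF, hpV⟩ := h (⋃ M ∈ F, ⋃ i, Set.range (M i))
    (Set.iUnion₂_subset fun M hM => Set.iUnion_subset fun i =>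
      Set.range_subset_iff.2 fun j => hFΩ hM i j)
    (hFfin.biUnion fun M _ => Set.finite_iUnion fun i => Set.finite_range _) δ hδ0
    (⋃ v ∈ V, Set.range v.ofLp) (hV.biUnion fun v _ => Set.finite_range _)
  refine ⟨matrixOperator (Matrix.diagonal fun _ => p), isStarProjection_matrixOperator_diagonal hp,
    finiteDimensional_range_matrixOperator_diagonal p, ?_, fun v hv => ?_⟩
  · rintro _ ⟨M, hM, rfl⟩
    calc _ ≤ ∑ i, ∑ j, ‖p * M i j - M i j * p‖ := norm_commutator_matrixOperator_diagonal_le p M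
      _ ≤ ∑ _i : ι, ∑ _j : ι, δ := by
        gcongr with i _ j
        exact hpF _ (Set.mem_biUnion hM (Set.mem_iUnion_of_mem i ⟨j, rfl⟩))
      _ = n ^ 2 * δ := by simp [n]; ring
      _ ≤ ε := by linarith
  · calc _ ≤ ∑ i, ‖p (v i) - v i‖ := by
          simpa only [PiLp.sub_apply, matrixOperator_diagonal_apply] using
            norm_le_sum_norm_apply (matrixOperator (Matrix.diagonal fun _ => p) v - v)
      _ ≤ ∑ _i : ι, δ := by
        gcongr with i
        exact hpV _ (Set.mem_biUnion hv ⟨i, rfl⟩)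
      _ = n * δ := by simp [n]
      _ ≤ ε := by nlinarith [sq_nonneg (n - 1)]

theorem IsQuasidiagonal.matrix {A : Type u} [Ring A] [StarRing A] [Algebra ℂ A]
    (h : IsQuasidiagonal A) : IsQuasidiagonal (Matrix ι ι A) := by
  obtain ⟨H, _, _, _, π, hπ, hQ⟩ := h
  let entrywise : Matrix ι ι A →⋆ₐ[ℂ] Matrix ι ι (H →L[ℂ] H) :=
    { π.toAlgHom.mapMatrix with
      map_star' := fun M => by
        ext1 i j
        exact map_star π (M j i) }
  refine ⟨PiLp 2 fun _ : ι => H, inferInstance, inferInstance, inferInstance,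
    matrixOperatorHom.comp entrywise, matrixOperator_injective.comp (Matrix.map_injective hπ), ?_⟩
  intro F hF
  refine hQ.image_matrixOperator F (hF.trans ?_)
  rintro _ ⟨M, rfl⟩
  exact ⟨M.map π, fun i j => ⟨M i j, rfl⟩, rfl⟩

end MatrixQuasidiagonal

theorem IsQuasidiagonal.isStablyFinite {A : Type u} [Ring A] [StarRing A] [Algebra ℂ A]
    (h : IsQuasidiagonal A) : IsStablyFinite A :=
  fun _ => h.matrix.isFiniteAlg

theorem IsStablyFinite.isFiniteAlg {A : Type u} [Ring A] [StarRing A]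
    (h : IsStablyFinite A) : IsFiniteAlg A := by
  rintro ⟨v, hv, hv'⟩
  have hstar : star (Matrix.diagonal fun _ : Fin 1 => v) = Matrix.diagonal fun _ => star v :=
    Matrix.diagonal_conjTranspose _
  refine h 1 ⟨Matrix.diagonal fun _ => v, ?_, fun hcoisometry => hv' ?_⟩
  · rw [hstar, Matrix.diagonal_mul_diagonal, hv, Matrix.diagonal_one]
  · rw [hstar, Matrix.diagonal_mul_diagonal] at hcoisometry
    simpa using congrFun (congrFun hcoisometry 0) 0

/-! ### Prefix expansions of groups -/

/-- The prefix expansion of the group `G`: the pairs of a finite subset of `G` and an element of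
`G` such that the subset contains `1` and the element. The product is
`(A, g) * (B, h) = (A ∪ g • B, g * h)`. -/
@[ext]
structure PrefixExpansion (G : Type u) [Group G] where
  support : Finset G
  value : G
  one_mem : 1 ∈ support
  value_mem : value ∈ support

namespace PrefixExpansion

open scoped Pointwise

variable {G : Type u} [Group G]

instance [Countable G] : Countable (PrefixExpansion G) := by
  have hinj : Function.Injective fun s : PrefixExpansion G => (s.support, s.value) :=
    fun s t h => PrefixExpansion.ext (congrArg Prod.fst h) (congrArg Prod.snd h)
  exact hinj.countable

variable [DecidableEq G]

instance : Mul (PrefixExpansion G) where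
  mul s t :=
    { support := s.support ∪ s.value • t.support
      value := s.value * t.value
      one_mem := Finset.mem_union_left _ s.one_mem
      value_mem := Finset.mem_union_right _ (Finset.smul_mem_smul_finset t.value_mem) }

instance : Inv (PrefixExpansion G) where
  inv s :=
    { support := s.value⁻¹ • s.support
      value := s.value⁻¹
      one_mem := by simpa using Finset.smul_mem_smul_finset (a := s.value⁻¹) s.value_mem
      value_mem := by simpa using Finset.smul_mem_smul_finset (a := s.value⁻¹) s.one_mem }

theorem support_mul (s t : PrefixExpansion G) :
    (s * t).support = s.support ∪ s.value • t.support := rfl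

theorem value_mul (s t : PrefixExpansion G) : (s * t).value = s.value * t.value := rfl

theorem support_inv (s : PrefixExpansion G) : s⁻¹.support = s.value⁻¹ • s.support := rfl

theorem value_inv (s : PrefixExpansion G) : s⁻¹.value = s.value⁻¹ := rfl

theorem smul_support_subset {s t : PrefixExpansion G} (h : s * t * s = s) :
    s.value • t.support ⊆ s.support := calc
  s.value • t.support ⊆ (s * t).support := Finset.subset_union_right
  _ ⊆ (s * t * s).support := Finset.subset_union_left
  _ = s.support := congrArg support h

instance : InverseSemigroup (PrefixExpansion G) where
  mul_assoc s t w := by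
    ext1
    · simp only [support_mul, value_mul, Finset.smul_finset_union, smul_smul, Finset.union_assoc]
    · simp only [value_mul, mul_assoc]
  mul_inv_mul_self s := by
    ext1
    · simp [support_mul, value_mul, support_inv, value_inv]
    · simp [value_mul, value_inv]
  inv_mul_self_mul_inv s := by
    ext1
    · simp [support_mul, value_mul, support_inv, value_inv]
    · simp [value_mul, value_inv]
  eq_inv_of_inverse s t h h' := by
    have hvalue : t.value = s.value⁻¹ := by
      have hv := congrArg value h
      rw [value_mul, value_mul, mul_eq_right] at hv
      exact eq_inv_of_mul_eq_one_right hv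
    refine PrefixExpansion.ext (Finset.Subset.antisymm ?_ ?_) hvalue
    · exact Finset.smul_finset_subset_iff.1 (smul_support_subset h)
    · rw [support_inv, ← hvalue]
      exact smul_support_subset h'

theorem isQuasiCountable [Countable G] : IsQuasiCountable (PrefixExpansion G) :=
  ⟨Set.univ, Set.countable_univ,
    fun _ => InverseSubsemigroup.subset_closure _ (Or.inl trivial)⟩

/-- The set of `s`, translated such that the value of `s` is moved to `1`. It parametrizes the
`𝓛`-classes. -/
def base (s : PrefixExpansion G) : Finset G := s.value⁻¹ • s.support

theorem inv_value_mem_base (s : PrefixExpansion G) : s.value⁻¹ ∈ s.base := s⁻¹.value_mem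

theorem base_mul (s t : PrefixExpansion G) : (s * t).base = t.value⁻¹ • s.base ∪ t.base := by
  simp only [base, support_mul, value_mul, mul_inv_rev, Finset.smul_finset_union, smul_smul,
    inv_mul_cancel_right]

theorem eq_of_base_eq {s t : PrefixExpansion G} (h : s.base = t.base) (h' : s.value = t.value) :
    s = t := by
  rw [base, base, h', smul_left_cancel_iff] at h
  exact PrefixExpansion.ext h h'

/-- The element with value `g` and the smallest base that contains `B`. -/
def ofBase (B : Finset G) (g : G) : PrefixExpansion G where
  support := {1, g} ∪ g • B
  value := g
  one_mem := by simp
  value_mem := by simp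

theorem base_ofBase (B : Finset G) (g : G) : (ofBase B g).base = {g⁻¹, 1} ∪ B := by
  simp [base, ofBase, Finset.smul_finset_insert]

theorem base_ofBase_of_mem {B : Finset G} {g : G} (h1 : 1 ∈ B) (hg : g⁻¹ ∈ B) :
    (ofBase B g).base = B := by
  rw [base_ofBase]
  exact Finset.union_eq_right.2 (by simp [Finset.insert_subset_iff, h1, hg])

theorem ofBase_empty_mul {s t : PrefixExpansion G} (h : s.base = t.base) :
    ofBase ∅ (t.value * s.value⁻¹) * s = t := by
  refine eq_of_base_eq ?_ (inv_mul_cancel_right _ _)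
  rw [base_mul, base_ofBase, Finset.union_empty, ← h]
  refine Finset.union_eq_right.2 ?_
  simp [Finset.smul_finset_insert, Finset.insert_subset_iff, s.inv_value_mem_base,
    h ▸ t.inv_value_mem_base]

theorem lRel_iff {s t : PrefixExpansion G} : LRel s t ↔ s.base = t.base := by
  have hsub : ∀ a s : PrefixExpansion G, s.base ⊆ (a * s).base := fun a s => by
    rw [base_mul]
    exact Finset.subset_union_right
  constructor
  · rintro ⟨⟨a, ha⟩, b, hb⟩
    exact Finset.Subset.antisymm (ha ▸ hsub a s) (hb ▸ hsub b t)
  · exact fun h => ⟨⟨_, ofBase_empty_mul h⟩, _, ofBase_empty_mul h.symm⟩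

section EMetric

variable [EMetricSpace G]

/-- The metric of `G`, evaluated at the values of two elements of the same `𝓛`-class. -/
noncomputable instance : EMetricSpace (PrefixExpansion G) where
  edist s t := if s.base = t.base then edist s.value t.value else ∞
  edist_self s := by simp
  edist_comm s t := by simp only [eq_comm (a := s.base), edist_comm s.value]
  edist_triangle s t w := by
    by_cases hst : s.base = t.base
    · by_cases htw : t.base = w.base
      · simpa only [hst, htw, if_true] using edist_triangle s.value t.value w.value
      · simp [htw]
    · simp [hst]
  eq_of_edist_eq_zero {s t} h := by
    split_ifs at h with hst
    · exact eq_of_base_eq hst (edist_eq_zero.1 h)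
    · exact absurd h ENNReal.top_ne_zero

theorem edist_of_base_eq {s t : PrefixExpansion G} (h : s.base = t.base) :
    edist s t = edist s.value t.value := if_pos h

theorem base_eq_of_edist_lt_top {s t : PrefixExpansion G} (h : edist s t < ∞) :
    s.base = t.base := by
  by_contra hst
  exact h.ne (if_neg hst)

theorem isProperRightSubinvariant (h : IsProperRightSubinvariant G) :
    IsProperRightSubinvariant (PrefixExpansion G) where
  uniformlyDiscrete := by
    obtain ⟨c, hc, hdisc⟩ := h.uniformlyDiscrete
    refine ⟨c, hc, fun s t hst => ?_⟩
    by_cases hbase : s.base = t.base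
    · rw [edist_of_base_eq hbase]
      exact hdisc _ _ fun hvalue => hst (eq_of_base_eq hbase hvalue)
    · exact not_le.1 fun hle => hbase (base_eq_of_edist_lt_top (hle.trans_lt ENNReal.coe_lt_top))
  component_eq s t := by
    refine ⟨fun hst => lRel_iff.2 (base_eq_of_edist_lt_top hst), fun hst => ?_⟩
    rw [edist_of_base_eq (lRel_iff.1 hst), h.component_eq]
    exact ⟨⟨_, inv_mul_cancel_right _ _⟩, _, inv_mul_cancel_right _ _⟩
  rightSubinvariant s t w := by
    by_cases hbase : s.base = t.base
    · rw [edist_of_base_eq hbase, edist_of_base_eq (by rw [base_mul, base_mul, hbase])]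
      exact h.rightSubinvariant _ _ _
    · exact le_top.trans_eq (if_neg hbase).symm
  proper r := by
    obtain ⟨F, hF, hmem⟩ := h.proper r
    refine ⟨ofBase ∅ '' F, hF.image _, fun s t hne hst => ?_⟩
    have hbase := base_eq_of_edist_lt_top (hst.trans_lt ENNReal.coe_lt_top)
    obtain ⟨f, hf, hvalue⟩ := hmem s.value t.value (fun hvalue => hne (eq_of_base_eq hbase hvalue))
      (edist_of_base_eq hbase ▸ hst)
    refine ⟨_, ⟨f, hf, rfl⟩, ?_⟩
    rw [eq_mul_inv_of_mul_eq hvalue.symm, ofBase_empty_mul hbase]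

theorem finite_component (p : PrefixExpansion G) : (component p).Finite := by
  refine Set.Finite.of_finite_image (f := fun s => s.value⁻¹)
    (p.base.finite_toSet.subset ?_) fun s hs t ht hst => ?_
  · rintro _ ⟨s, hs, rfl⟩
    rw [base_eq_of_edist_lt_top hs]
    exact s.inv_value_mem_base
  · exact eq_of_base_eq ((base_eq_of_edist_lt_top hs).symm.trans (base_eq_of_edist_lt_top ht))
      (inv_injective hst)

theorem isSparse : IsSparse (PrefixExpansion G) :=
  HasFiniteRipsComponents.isSparse
    (fun _ p => (finite_component p).subset fun _ hy => hy.trans_lt ENNReal.coe_lt_top)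
    (fun _ p => (finite_component p).subset fun _ hy => edist_lt_top_of_reachable hy)

theorem reachable_ofBase {r : ℝ≥0} {x y : G} (w : (ripsGraph G r).Walk x y) {B : Finset G}
    (h1 : 1 ∈ B) (hB : ∀ z ∈ w.support, z⁻¹ ∈ B) :
    (ripsGraph (PrefixExpansion G) r).Reachable (ofBase B x) (ofBase B y) := by
  induction w with
  | nil => exact .rfl
  | @cons x z y hxz w ih =>
    rw [SimpleGraph.Walk.support_cons, List.forall_mem_cons] at hB
    refine (reachable_of_edist_le ?_).trans (ih hB.2)
    rw [edist_of_base_eq]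
    · exact hxz.2
    · rw [base_ofBase_of_mem h1 hB.1, base_ofBase_of_mem h1 (hB.2 z w.start_mem_support)]

end EMetric

end PrefixExpansion

open PrefixExpansion in
theorem HasAsdimZero.of_prefixExpansion {G : Type u} [Group G] [DecidableEq G] [EMetricSpace G]
    (h : HasAsdimZero (PrefixExpansion G)) : HasAsdimZero G := by
  refine hasAsdimZero_iff.2 fun r => ?_
  obtain ⟨D, hD⟩ := hasAsdimZero_iff.1 h r
  refine ⟨D, fun x y ⟨w⟩ => ?_⟩
  let B : Finset G := insert 1 (w.support.toFinset.image (·⁻¹))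
  have hB : ∀ z ∈ w.support, z⁻¹ ∈ B := fun z hz =>
    Finset.mem_insert_of_mem (Finset.mem_image_of_mem _ (List.mem_toFinset.2 hz))
  have h1 : 1 ∈ B := Finset.mem_insert_self _ _
  have hbase : (ofBase B x).base = (ofBase B y).base := by
    rw [base_ofBase_of_mem h1 (hB x w.start_mem_support),
      base_ofBase_of_mem h1 (hB y w.end_mem_support)]
  exact (edist_of_base_eq hbase).symm.trans_le (hD _ _ (reachable_ofBase w h1 hB))

section Integers

open Multiplicative

theorem edist_ofAdd_int (m n : ℤ) : edist (ofAdd m) (ofAdd n) = ((m - n).natAbs : ℝ≥0) := by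
  rw [edist_ofAdd, edist_nndist]
  congr 1
  ext
  simp [Int.dist_eq, Nat.cast_natAbs]

theorem isProperRightSubinvariant_int : IsProperRightSubinvariant (Multiplicative ℤ) where
  uniformlyDiscrete := by
    refine ⟨2⁻¹, by positivity, fun m n hmn => ?_⟩
    obtain ⟨m, rfl⟩ := ofAdd.surjective m
    obtain ⟨n, rfl⟩ := ofAdd.surjective n
    have hone : 1 ≤ (m - n).natAbs := by
      have : m ≠ n := fun h => hmn (h ▸ rfl)
      omega
    rw [edist_ofAdd_int, ENNReal.coe_lt_coe]
    calc (2⁻¹ : ℝ≥0) < 1 := by norm_num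
      _ ≤ (m - n).natAbs := by exact_mod_cast hone
  component_eq m n := by
    refine ⟨fun _ => ?_, fun _ => edist_lt_top _ _⟩
    exact ⟨⟨_, inv_mul_cancel_right _ _⟩, _, inv_mul_cancel_right _ _⟩
  rightSubinvariant m n k := (edist_mul_right m n k).le
  proper r := by
    obtain ⟨N, hN⟩ := exists_nat_ge r
    refine ⟨ofAdd '' Set.Icc (-N : ℤ) N, (Set.finite_Icc _ _).image _, fun m n _ hmn => ?_⟩
    obtain ⟨m, rfl⟩ := ofAdd.surjective m
    obtain ⟨n, rfl⟩ := ofAdd.surjective n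
    rw [edist_ofAdd_int, ENNReal.coe_le_coe] at hmn
    have hle : (m - n).natAbs ≤ N := by exact_mod_cast hmn.trans hN
    exact ⟨ofAdd (n - m), ⟨n - m, ⟨by omega, by omega⟩, rfl⟩, by rw [← ofAdd_add, sub_add_cancel]⟩

theorem not_hasAsdimZero_int : ¬ HasAsdimZero (Multiplicative ℤ) := by
  intro h
  obtain ⟨D, hD⟩ := hasAsdimZero_iff.1 h 1
  obtain ⟨N, hN⟩ := exists_nat_gt D
  have hreach : ∀ n : ℕ, (ripsGraph (Multiplicative ℤ) 1).Reachable (ofAdd 0) (ofAdd n) := by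
    intro n
    induction n with
    | zero => exact .rfl
    | succ n ih =>
      refine ih.trans (reachable_of_edist_le ?_)
      rw [edist_ofAdd_int]
      simp
  have hle := hD _ _ (hreach N)
  rw [edist_ofAdd_int, ENNReal.coe_le_coe] at hle
  exact hN.not_ge (by simpa using hle)

end Integers

theorem exists_isSparse_not_hasAsdimZero :
    ∃ (T : Type) (_ : InverseSemigroup T) (_ : EMetricSpace T),
      IsQuasiCountable T ∧ IsProperRightSubinvariant T ∧ IsSparse T ∧ ¬ HasAsdimZero T :=
  ⟨PrefixExpansion (Multiplicative ℤ), inferInstance, inferInstance,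
    PrefixExpansion.isQuasiCountable,
    PrefixExpansion.isProperRightSubinvariant isProperRightSubinvariant_int,
    PrefixExpansion.isSparse, fun h => not_hasAsdimZero_int h.of_prefixExpansion⟩

end InvSemigroupRoe

theorem theorem5p12_general :
    (∀ (S : Type u) [InverseSemigroup S] [EMetricSpace S],
      (∀ x y : S, LRel x y → edist x y < ∞) → IsRightSubinvariant S → IsProper S →
        List.TFAE
          [IsLocallyLFinite S,
            IsSparse S,
            IsQuasidiagonal (uniformRoeAlgebra S),
            IsStablyFinite (uniformRoeAlgebra S),
            IsFiniteAlg (uniformRoeAlgebra S)] ∧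
        (HasAsdimZero S → IsSparse S)) ∧
    (∀ (G : Type u) [Group G] [EMetricSpace G],
      IsRightSubinvariant G → IsSparse G → HasAsdimZero G) := by
  refine ⟨fun S _ _ hfin hinv hproper => ?_,
    fun G _ _ hinv hsparse => hsparse.hasFiniteRipsComponents.hasAsdimZero hinv⟩
  have hballs : HasFiniteBalls S := hproper.hasFiniteBalls
  refine ⟨?_, fun h => (h.hasFiniteRipsComponents hballs).isSparse hballs⟩
  tfae_have 1 → 2 := fun h => (h.hasFiniteRipsComponents hproper).isSparse hballs
  tfae_have 2 → 1 := fun h => h.hasFiniteRipsComponents.isLocallyLFinite hfin hinv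
  tfae_have 2 → 3 := fun h => h.hasFiniteRipsComponents.isQuasidiagonal
  tfae_have 3 → 4 := IsQuasidiagonal.isStablyFinite
  tfae_have 4 → 5 := IsStablyFinite.isFiniteAlg
  tfae_have 5 → 2 := fun h => (hasFiniteRipsComponents_of_isFiniteAlg hballs h).isSparse hballs
  tfae_finish

theorem theorem5p12 :
    -- the five conditions are equivalent, and asymptotic dimension `0` implies them
    (∀ (S : Type u) [InverseSemigroup S] [EMetricSpace S],
      IsQuasiCountable S → IsProperRightSubinvariant S →
        List.TFAE
          [IsLocallyLFinite S,
            IsSparse S,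
            IsQuasidiagonal (uniformRoeAlgebra S),
            IsStablyFinite (uniformRoeAlgebra S),
            IsFiniteAlg (uniformRoeAlgebra S)] ∧
        (HasAsdimZero S → IsSparse S)) ∧
    -- the converse fails
    (∃ (T : Type) (_ : InverseSemigroup T) (_ : EMetricSpace T),
      IsQuasiCountable T ∧ IsProperRightSubinvariant T ∧ IsSparse T ∧ ¬ HasAsdimZero T) ∧
    -- the converse holds for groups
    (∀ (G : Type u) [Group G] [EMetricSpace G],
      IsQuasiCountable G → IsProperRightSubinvariant G → IsSparse G → HasAsdimZero G) :=
  ⟨fun S _ _ _ h => theorem5p12_general.1 S (fun x y => (h.component_eq x y).2)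
      h.rightSubinvariant h.proper,
    exists_isSparse_not_hasAsdimZero,
    fun G _ _ _ h => theorem5p12_general.2 G h.rightSubinvariant⟩
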